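/- Corollary 4.6. Let $A$ and $B$ be (complex, not necessarily unital) $C^*$-algebras, and let $\varphi\colon A\to B$ be a bounded linear map that is self-adjoint, that is, $\varphi(a^*)=\varphi(a)^*$ for all $a\in A$, and that preserves zero-products, that is, $\varphi(a)\varphi(b)=0$ for all $a,b\in A$ with $ab=0$. Let $C:=C^*(\varphi(A))\subseteq B$ be the sub-$C^*$-algebra of $B$ generated by the image of $\varphi$. Let $\varphi^{**}\colon A^{**}\to B^{**}$ be the bitranspose of $\varphi$, let $1$ be the unit of the von Neumann algebra $A^{**}$, and regard the multiplier algebra $M(C)$ as a subalgebra of $C^{**}\subseteq B^{**}$. Then $h:=\varphi^{**}(1)\in B^{**}$ belongs to $M(C)\cap C'$, that is, $h$ lies in $M(C)$ and commutes with every element of $C$. Moreover, there exists a $*$-homomorphism $\pi_\varphi\colon A\to M(C)\cap\{h\}'$ (that is, with values in the elements of $M(C)$ that commute with $h$) such that \[ \varphi(a)=h\,\pi_\varphi(a)\quad\text{for all } a\in A. \] It is canonical: it satisfies $\pi_\varphi(a)\varphi(b)=\varphi(ab)=\varphi(a)\pi_\varphi(b)$ for all $a,b\in A$, and it is the only $*$-homomorphism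 $\pi\colon A\to M(C)\cap\{h\}'$ with $\varphi(a)=h\pi(a)$ for all $a\in A$. -/

import Mathlib

open scoped MultiplierAlgebra

noncomputable section

/-- The bidual `A**` of a complex normed space, as a Banach space. -/
abbrev Bidual (A : Type*) [NormedAddCommGroup A] [NormedSpace ℂ A] : Type _ :=
  StrongDual ℂ (StrongDual ℂ A)

namespace Bidual

section NormedSpace

variable {A B : Type*} [NormedAddCommGroup A] [NormedSpace ℂ A]
  [NormedAddCommGroup B] [NormedSpace ℂ B]

/-- The transpose `φ* : B* → A*`, `f ↦ f ∘ φ`, of a bounded linear map `φ : A → B`. -/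
def transpose (φ : A →L[ℂ] B) : StrongDual ℂ B →L[ℂ] StrongDual ℂ A :=
  (ContinuousLinearMap.compL ℂ A B ℂ).flip φ

@[simp] theorem transpose_apply (φ : A →L[ℂ] B) (f : StrongDual ℂ B) (a : A) :
    transpose φ f a = f (φ a) := rfl

/-- The bitranspose `φ** : A** → B**` of a bounded linear map `φ : A → B`. -/
def bitranspose (φ : A →L[ℂ] B) : Bidual A →L[ℂ] Bidual B :=
  transpose (transpose φ)

@[simp] theorem bitranspose_apply (φ : A →L[ℂ] B) (x : Bidual A) (f : StrongDual ℂ B) :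
    bitranspose φ x f = x (transpose φ f) := rfl

/-- The canonical embedding `A → A**`. -/
def incl : A →L[ℂ] Bidual A := NormedSpace.inclusionInDoubleDual ℂ A

@[simp] theorem incl_apply (a : A) (f : StrongDual ℂ A) : incl a f = f a := rfl

end NormedSpace

section Algebra

variable {A : Type*} [NonUnitalCStarAlgebra A]

/-- The functional `f · a : b ↦ f (a * b)`. -/
def actRight (f : StrongDual ℂ A) (a : A) : StrongDual ℂ A :=
  f ∘L ContinuousLinearMap.mul ℂ A a

@[simp] theorem actRight_apply (f : StrongDual ℂ A) (a b : A) : actRight f a b = f (a * b) := rfl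

/-- The functional `x · f : a ↦ x (f · a)`, for `x : A**` and `f : A*`. -/
def actLeft (x : Bidual A) (f : StrongDual ℂ A) : StrongDual ℂ A :=
  x ∘L (ContinuousLinearMap.compL ℂ A A ℂ f) ∘L ContinuousLinearMap.mul ℂ A

@[simp] theorem actLeft_apply (x : Bidual A) (f : StrongDual ℂ A) (a : A) :
    actLeft x f a = x (actRight f a) := rfl

/-- The (Arens) product of the bidual: `(x □ y)(f) = x (y · f)`. It extends the product of `A`,
and for a C⋆-algebra it is the product of the von Neumann algebra `A**`. -/
def arens (x y : Bidual A) : Bidual A :=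
  x ∘L ((ContinuousLinearMap.compL ℂ A (StrongDual ℂ A) ℂ y) ∘L
    ((ContinuousLinearMap.compL ℂ A (A →L[ℂ] A) (StrongDual ℂ A)).flip
      (ContinuousLinearMap.mul ℂ A)) ∘L ContinuousLinearMap.compL ℂ A A ℂ)

@[simp] theorem arens_apply (x y : Bidual A) (f : StrongDual ℂ A) :
    arens x y f = x (actLeft y f) := rfl

theorem arens_incl_incl (a b : A) : arens (incl a) (incl b) = incl (a * b) := rfl

/-- A norm estimate used to construct the unit of the bidual. -/
theorem norm_sq_le_aux {U : Type*} [CStarAlgebra U] [PartialOrder U] [StarOrderedRing U]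
    (e u c : U) (he : 0 ≤ e) (he1 : ‖e‖ ≤ 1) :
    ‖e * u + (c - e * c)‖ ^ 2 ≤ ‖u‖ ^ 2 + ‖c‖ ^ 2 := by
  have hs : star e = e := (IsSelfAdjoint.of_nonneg he).star_eq
  have h1 : e ≤ 1 := (CStarAlgebra.norm_le_one_iff_of_nonneg e he).1 he1
  have h1' : 0 ≤ 1 - e := sub_nonneg.2 h1
  have hp : 0 ≤ e - e * e := by
    have a1 := star_left_conjugate_nonneg h1' e
    have a2 := star_left_conjugate_nonneg he (1 - e)
    have := add_nonneg a1 a2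
    simp only [star_sub, star_one, hs] at this
    convert this using 1
    noncomm_ring
  have key : ∀ v : U, star v * (e * e + (1 - e) * (1 - e)) * v ≤ star v * v := by
    intro v
    have := star_left_conjugate_nonneg (add_nonneg hp hp) v
    rw [← sub_nonneg]
    convert this using 1
    noncomm_ring
  set x := e * u + (c - e * c) with hx
  set y := (1 - e) * u - e * c with hy
  have hxy : star x * x ≤ star u * u + star c * c := by
    calc star x * x ≤ star x * x + star y * y := le_add_of_nonneg_right (star_mul_self_nonneg y)
      _ = star u * (e * e + (1 - e) * (1 - e)) * u
          + star c * (e * e + (1 - e) * (1 - e)) * c := by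
        simp only [hx, hy, star_add, star_sub, star_mul, star_one, hs]
        noncomm_ring
      _ ≤ _ := add_le_add (key u) (key c)
  have h2 := CStarAlgebra.norm_le_norm_of_nonneg_of_le (star_mul_self_nonneg x) hxy
  calc ‖x‖ ^ 2 = ‖star x * x‖ := by rw [CStarRing.norm_star_mul_self, sq]
    _ ≤ ‖star u * u + star c * c‖ := h2
    _ ≤ ‖star u * u‖ + ‖star c * c‖ := norm_add_le _ _
    _ = _ := by rw [CStarRing.norm_star_mul_self, CStarRing.norm_star_mul_self, sq, sq]

theorem norm_sq_le_aux' [PartialOrder A] [StarOrderedRing A] (e u c : A)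
    (he : 0 ≤ e) (he1 : ‖e‖ ≤ 1) : ‖e * u + (c - e * c)‖ ^ 2 ≤ ‖u‖ ^ 2 + ‖c‖ ^ 2 := by
  have := norm_sq_le_aux (e : Unitization ℂ A) (u : Unitization ℂ A) (c : Unitization ℂ A)
    (by simpa using he) (by simpa [Unitization.norm_inr] using he1)
  simpa only [← Unitization.inr_mul, ← Unitization.inr_sub, ← Unitization.inr_add,
    Unitization.norm_inr] using this

open Filter Topology in
/-- For a bounded functional `f`, the functionals `f · e` tend to `f` in norm as `e` runs through
the canonical approximate unit. -/
theorem tendsto_actRight [PartialOrder A] [StarOrderedRing A] (f : StrongDual ℂ A) :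
    Tendsto (fun e => actRight f e) (CStarAlgebra.approximateUnit A) (𝓝 f) := by
  have hl := CStarAlgebra.increasingApproximateUnit A
  rw [Metric.tendsto_nhds]
  intro ε hε
  obtain ⟨t, ht, htε⟩ : ∃ t : ℝ, 0 < t ∧ (‖f‖ / 2 + 2) * t < ε := by
    refine ⟨ε / (‖f‖ / 2 + 3), by positivity, ?_⟩
    rw [mul_div_assoc', div_lt_iff₀ (by positivity)]
    nlinarith [norm_nonneg f]
  -- a vector almost norming `f`, with positive value
  obtain ⟨u, hu1, hu⟩ : ∃ u : A, ‖u‖ ≤ 1 ∧ ‖f‖ - t ^ 2 ≤ (f u).re := by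
    obtain ⟨v, hv1, hv⟩ : ∃ v : A, ‖v‖ ≤ 1 ∧ ‖f‖ - t ^ 2 ≤ ‖f v‖ := by
      by_contra! hcon
      have hb : ‖f‖ ≤ max 0 (‖f‖ - t ^ 2) := by
        refine ContinuousLinearMap.opNorm_le_of_unit_norm (le_max_left _ _) ?_
        intro v hv
        exact (hcon v hv.le).le.trans (le_max_right _ _)
      rcases le_max_iff.1 hb with h0 | h0
      · have := hcon 0 (by simp)
        have h1 := norm_nonneg (f 0)
        nlinarith [sq_nonneg t]
      · nlinarith [pow_pos ht 2]
    obtain ⟨z, hz, hzv⟩ := RCLike.exists_norm_eq_mul_self (f v)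
    refine ⟨z • v, by simpa [norm_smul, hz] using hv1, ?_⟩
    rw [map_smul, smul_eq_mul, ← hzv]
    simpa using hv
  have h1 : ∀ᶠ e in CStarAlgebra.approximateUnit A, ‖f (e * u) - f u‖ < t ^ 2 := by
    have := ((f.continuous.tendsto u).comp (hl.tendsto_mul_right u))
    rw [Metric.tendsto_nhds] at this
    simpa [dist_eq_norm] using this (t ^ 2) (by positivity)
  filter_upwards [h1, hl.eventually_nonneg, hl.eventually_norm] with e he he0 he1
  rw [dist_eq_norm]
  refine lt_of_le_of_lt ?_ htε
  refine ContinuousLinearMap.opNorm_le_of_unit_norm (by positivity) ?_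
  intro c hc
  obtain ⟨z, hz, hzc⟩ := RCLike.exists_norm_eq_mul_self (f (c - e * c))
  have hr : ‖(actRight f e - f) c‖ = ‖f (c - e * c)‖ := by
    rw [sub_apply, actRight_apply, map_sub, norm_sub_rev]
  rw [hr]
  set r := ‖f (c - e * c)‖ with hrdef
  have h2 := norm_sq_le_aux' e u ((t : ℂ) • z • c) he0 he1
  have h3 : ‖((t : ℂ) • z • c)‖ ≤ t := by
    rw [norm_smul, norm_smul, hz, Complex.norm_real, Real.norm_of_nonneg ht.le]
    nlinarith
  set w := e * u + ((t : ℂ) • z • c - e * ((t : ℂ) • z • c)) with hw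
  have hw2 : ‖w‖ ^ 2 ≤ (1 + t ^ 2 / 2) ^ 2 := by
    have a1 : ‖u‖ ^ 2 ≤ 1 := by nlinarith [norm_nonneg u]
    have a2 : ‖((t : ℂ) • z • c)‖ ^ 2 ≤ t ^ 2 := by
      exact pow_le_pow_left₀ (norm_nonneg _) h3 2
    nlinarith [sq_nonneg (t ^ 2)]
  have hw1 : ‖w‖ ≤ 1 + t ^ 2 / 2 := (pow_le_pow_iff_left₀ (norm_nonneg _) (by positivity) two_ne_zero).1 hw2
  have hfw : f w = f (e * u) + (t : ℂ) * (r : ℂ) := by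
    have : w = e * u + (t : ℂ) • z • (c - e * c) := by
      rw [hw]; simp only [mul_smul_comm, smul_sub]
    rw [this, map_add, map_smul, map_smul, smul_eq_mul, smul_eq_mul, ← hzc]
    rfl
  have h4 : (f (e * u)).re + t * r ≤ ‖f‖ * (1 + t ^ 2 / 2) := by
    calc (f (e * u)).re + t * r = (f w).re := by
          rw [hfw, Complex.add_re, ← Complex.ofReal_mul, Complex.ofReal_re]
      _ ≤ ‖f w‖ := Complex.re_le_norm _
      _ ≤ ‖f‖ * ‖w‖ := f.le_opNorm w
      _ ≤ _ := by gcongr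
  have h5 : (f u).re - (f (e * u)).re < t ^ 2 := by
    have := Complex.abs_re_le_norm (f (e * u) - f u)
    rw [Complex.sub_re] at this
    have := (abs_le.1 this).1
    linarith
  have h6 : t * r ≤ t * ((‖f‖ / 2 + 2) * t) := by nlinarith
  exact le_of_mul_le_mul_left h6 ht

open Filter Topology in
/-- The bidual of a C⋆-algebra has a two-sided unit. -/
theorem exists_unit (A : Type*) [NonUnitalCStarAlgebra A] :
    ∃ e : Bidual A, ∀ x : Bidual A, arens e x = x ∧ arens x e = x := by
  let _ := CStarAlgebra.spectralOrder A
  have _ := CStarAlgebra.spectralOrderedRing A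
  have hl := CStarAlgebra.increasingApproximateUnit A
  let U : Ultrafilter A := Ultrafilter.of (CStarAlgebra.approximateUnit A)
  have hU : (U : Filter A) ≤ CStarAlgebra.approximateUnit A := Ultrafilter.of_le _
  obtain ⟨e, he⟩ : ∃ e : Bidual A, ∀ f : StrongDual ℂ A, Tendsto (fun a => f a) U (𝓝 (e f)) := by
    have hc := WeakDual.isCompact_closedBall (𝕜 := ℂ) (E := StrongDual ℂ A) 0 1
    obtain ⟨e, -, he⟩ := hc.ultrafilter_le_nhds
      (U.map fun a => StrongDual.toWeakDual (incl a)) (by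
        rw [le_principal_iff]
        change _ ∈ Filter.map _ (U : Filter A)
        rw [Filter.mem_map]
        filter_upwards [hU hl.eventually_norm] with a ha
        have : ‖incl a‖ ≤ 1 := by
          refine ContinuousLinearMap.opNorm_le_bound _ zero_le_one fun f => ?_
          calc ‖f a‖ ≤ ‖f‖ * ‖a‖ := f.le_opNorm a
            _ ≤ 1 * ‖f‖ := by nlinarith [norm_nonneg f]
        simpa using this)
    refine ⟨WeakDual.toStrongDual e, fun f => ?_⟩
    exact ((WeakDual.eval_continuous f).tendsto e).comp he
  refine ⟨e, fun x => ⟨?_, ?_⟩⟩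
  · ext f
    have h1 : Tendsto (fun a => x (actRight f a)) U (𝓝 (x f)) :=
      (x.continuous.tendsto f).comp ((tendsto_actRight f).mono_left hU)
    exact tendsto_nhds_unique (he (actLeft x f)) h1
  · ext f
    have : actLeft e f = f := by
      ext a
      have h1 : Tendsto (fun b => f (a * b)) U (𝓝 (f a)) :=
        (f.continuous.tendsto a).comp ((hl.tendsto_mul_left a).mono_left hU)
      exact tendsto_nhds_unique (he (actRight f a)) h1
    rw [arens_apply, this]

variable (A) in
/-- The unit of the bidual `A**`. (A two-sided unit is unique.) -/
def one : Bidual A := (exists_unit A).choose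

theorem one_arens (x : Bidual A) : arens (one A) x = x := ((exists_unit A).choose_spec x).1

theorem arens_one (x : Bidual A) : arens x (one A) = x := ((exists_unit A).choose_spec x).2

/-- The canonical embedding `M(A) → A**` of the multiplier algebra of `A` (realised by double
centralizers `m = (L, R)`) in the bidual, `m ↦ L**(1)`. Its value at `m` is the element of `A**`
with `x □ a = L a` and `a □ x = R a` for all `a ∈ A`; see the next two lemmas. -/
def ofMultiplier (m : 𝓜(ℂ, A)) : Bidual A := bitranspose m.fst (one A)

theorem ofMultiplier_arens_incl (m : 𝓜(ℂ, A)) (a : A) :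
    arens (ofMultiplier m) (incl a) = incl (m.fst a) := by
  have hm : ∀ b c : A, m.fst (b * c) = m.fst b * c := by
    intro b c
    have h0 : ∀ d : A, d * (m.fst (b * c) - m.fst b * c) = 0 := by
      intro d
      rw [mul_sub, ← mul_assoc, ← m.central, ← m.central, mul_assoc, sub_self]
    have := h0 (star (m.fst (b * c) - m.fst b * c))
    rwa [CStarRing.star_mul_self_eq_zero_iff, sub_eq_zero] at this
  ext f
  have h1 : transpose m.fst (actLeft (incl a) f) = actLeft (incl a) (transpose m.fst f) := by
    ext b
    simp [hm]
  change one A (transpose m.fst (actLeft (incl a) f)) = f (m.fst a)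
  rw [h1, ← arens_apply, one_arens]
  rfl

theorem incl_arens_ofMultiplier (m : 𝓜(ℂ, A)) (a : A) :
    arens (incl a) (ofMultiplier m) = incl (m.snd a) := by
  ext f
  have h1 : transpose m.fst (actRight f a) = actRight f (m.snd a) := by
    ext b
    simp [m.central]
  change one A (transpose m.fst (actRight f a)) = f (m.snd a)
  rw [h1, ← actLeft_apply]
  change arens (incl (m.snd a)) (one A) f = _
  rw [arens_one]
  rfl

end Algebra

end Bidual

section

variable {A B : Type*} [NonUnitalCStarAlgebra A] [NonUnitalCStarAlgebra B]

/-- The sub-C⋆-algebra `C*(φ(A))` of `B` generated by the image of `φ : A → B`. -/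
def cstarRange (φ : A →L[ℂ] B) : NonUnitalStarSubalgebra ℂ B :=
  (NonUnitalStarAlgebra.adjoin ℂ (Set.range φ)).topologicalClosure

instance cstarRange_isClosed (φ : A →L[ℂ] B) : IsClosed (cstarRange φ : Set B) :=
  NonUnitalStarSubalgebra.isClosed_topologicalClosure _

/-- The inclusion `C*(φ(A)) → B`, as a bounded linear map. -/
def cstarRangeIncl (φ : A →L[ℂ] B) : cstarRange φ →L[ℂ] B where
  toFun c := c
  map_add' _ _ := rfl
  map_smul' _ _ := rfl
  cont := continuous_subtype_val

/-- The map `φ : A → C*(φ(A))` with restricted codomain. -/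
def toCstarRange (φ : A →L[ℂ] B) (a : A) : cstarRange φ :=
  ⟨φ a, NonUnitalStarSubalgebra.le_topologicalClosure _
    (NonUnitalStarAlgebra.subset_adjoin ℂ _ (Set.mem_range_self a))⟩

end

end

/-! Everything rests on the balance identity `φ (a * b) * φ c = φ a * φ (b * c)`. For self-adjoint
`b` it is read off from the bilinear map `(z, y) ↦ φ (a z) * φ (y c)` on the unitization, which
kills zero products: on the functional calculus of `b`, cutting a function into small pieces shows
that such a map cannot distinguish `(f, 1)` from `(1, f)` (`ContinuousMap.bilin_one_comm`).

Given balance, `π a` is forced to be `ψ b * c ↦ ψ (a * b) * c` and `h` to be `ψ (a * b) * c ↦ ψ a *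
ψ b * c`, where `ψ` is `φ` with codomain `C`. Sums of such vectors are dense in `C`, so only norm
bounds are needed. For `π` the bound comes from positivity of `‖z‖ ^ 2 - star z * z`
(`norm_lactMap_le`); for `h`, from `ψ e * ψ (a * b) → ψ a * ψ b` along an approximate unit. The same
limit identifies `h` with the bitranspose at `1`. -/

open scoped MultiplierAlgebra

/-! ### Bilinear maps on `C(K, ℝ)` that vanish on zero products -/

section ZeroProduct

/-- A finite sum of pairwise disjointly supported functions is bounded by the common bound. -/
theorem ContinuousMap.norm_sum_le_of_disjoint {K ι : Type*} [TopologicalSpace K] [CompactSpace K]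
    (s : Finset ι) (p : ι → C(K, ℝ)) {c : ℝ} (hc : 0 ≤ c) (hp : ∀ i ∈ s, ‖p i‖ ≤ c)
    (hd : ∀ i ∈ s, ∀ j ∈ s, i ≠ j → p i * p j = 0) : ‖∑ i ∈ s, p i‖ ≤ c := by
  rw [ContinuousMap.norm_le _ hc]
  intro x
  rw [ContinuousMap.sum_apply]
  by_cases h : ∃ i ∈ s, p i x ≠ 0
  · obtain ⟨i, hi, hx⟩ := h
    rw [Finset.sum_eq_single_of_mem i hi]
    · exact ((p i).norm_coe_le_norm x).trans (hp i hi)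
    · intro j hj hji
      have := congrArg (fun f : C(K, ℝ) => f x) (hd j hj i hi hji)
      simpa [hx] using this
  · push Not at h
    rw [Finset.sum_eq_zero h]
    simpa using hc

variable {X : Type*} [NormedAddCommGroup X] [NormedSpace ℝ X]

/-- The off-diagonal terms vanish, so the diagonal sum is `w` evaluated at the two total sums. The
bound is therefore independent of the size of `s`. -/
theorem ContinuousMap.norm_sum_bilin_le {K ι : Type*} [TopologicalSpace K] [CompactSpace K]
    (w : C(K, ℝ) →ₗ[ℝ] C(K, ℝ) →ₗ[ℝ] X) {c : ℝ} (hc : 0 ≤ c)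
    (hb : ∀ f g, ‖w f g‖ ≤ c * ‖f‖ * ‖g‖) (hw : ∀ f g, f * g = 0 → w f g = 0)
    (s : Finset ι) (p q : ι → C(K, ℝ)) {a b : ℝ} (ha : 0 ≤ a) (hb' : 0 ≤ b)
    (hp : ∀ i ∈ s, ‖p i‖ ≤ a) (hq : ∀ i ∈ s, ‖q i‖ ≤ b)
    (hpp : ∀ i ∈ s, ∀ j ∈ s, i ≠ j → p i * p j = 0)
    (hqq : ∀ i ∈ s, ∀ j ∈ s, i ≠ j → q i * q j = 0)
    (hpq : ∀ i ∈ s, ∀ j ∈ s, i ≠ j → p i * q j = 0) :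
    ‖∑ i ∈ s, w (p i) (q i)‖ ≤ c * a * b := by
  have h : ∑ i ∈ s, w (p i) (q i) = w (∑ i ∈ s, p i) (∑ i ∈ s, q i) := by
    simp only [map_sum, LinearMap.sum_apply]
    rw [Finset.sum_comm]
    refine Finset.sum_congr rfl fun i hi => ?_
    rw [Finset.sum_eq_single_of_mem i hi]
    intro j hj hji
    exact hw _ _ (hpq _ ‹_› _ ‹_› (by first | exact hji | exact hji.symm))
  rw [h]
  refine (hb _ _).trans ?_
  gcongr
  · exact ContinuousMap.norm_sum_le_of_disjoint s p ha hp hpp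
  · exact ContinuousMap.norm_sum_le_of_disjoint s q hb' hq hqq

/-- The piecewise linear hat function `max 0 (1 - |t|)`. -/
def hatFun (t : ℝ) : ℝ := max 0 (1 - |t|)

/-- The trapezoid function, equal to `1` on `[-1, 1]` and to `0` off `(-2, 2)`. -/
def trapFun (t : ℝ) : ℝ := min 1 (max 0 (2 - |t|))

theorem continuous_hatFun : Continuous hatFun := by unfold hatFun; fun_prop
theorem continuous_trapFun : Continuous trapFun := by unfold trapFun; fun_prop

theorem hatFun_nonneg (t : ℝ) : 0 ≤ hatFun t := le_max_left _ _
theorem hatFun_le_one (t : ℝ) : hatFun t ≤ 1 := max_le zero_le_one (by linarith [abs_nonneg t])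
theorem hatFun_eq_zero {t : ℝ} (h : 1 ≤ |t|) : hatFun t = 0 := max_eq_left (by linarith)
theorem trapFun_nonneg (t : ℝ) : 0 ≤ trapFun t := le_min zero_le_one (le_max_left _ _)
theorem trapFun_le_one (t : ℝ) : trapFun t ≤ 1 := min_le_left _ _
theorem trapFun_eq_zero {t : ℝ} (h : 2 ≤ |t|) : trapFun t = 0 := by
  rw [trapFun, max_eq_left (by linarith)]; simp
theorem trapFun_eq_one {t : ℝ} (h : |t| ≤ 1) : trapFun t = 1 :=
  min_eq_left (le_max_of_le_right (by linarith))

theorem hatFun_mul_trapFun (t : ℝ) : hatFun t * trapFun t = hatFun t := by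
  rcases le_total |t| 1 with h | h
  · rw [trapFun_eq_one h, mul_one]
  · rw [hatFun_eq_zero h, zero_mul]

/-- Only the indices `⌊t⌋` and `⌊t⌋ + 1` contribute; the strict inequality `|t| < N` keeps the
second one in range. -/
theorem sum_hatFun {t : ℝ} {N : ℤ} (ht : |t| < N) :
    ∑ i ∈ Finset.Icc (-N) N, hatFun (t - i) = 1 := by
  obtain ⟨h1, h2⟩ := abs_lt.1 ht
  have f1 := Int.floor_le t
  have f2 := Int.lt_floor_add_one t
  have m1 : -N ≤ ⌊t⌋ := Int.le_floor.2 (by push_cast; exact h1.le)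
  have m2 : ⌊t⌋ < N := Int.floor_lt.2 h2
  rw [Finset.sum_eq_add_of_mem ⌊t⌋ (⌊t⌋ + 1) (by simp; omega) (by simp; omega) (by omega)]
  · rw [hatFun, hatFun, abs_of_nonneg (by linarith), abs_of_nonpos (by push_cast; linarith),
      max_eq_right (by linarith), max_eq_right (by push_cast; linarith)]
    push_cast; ring
  · rintro i - ⟨hi1, hi2⟩
    apply hatFun_eq_zero
    rcases lt_or_gt_of_ne hi1 with h | h
    · have : (i : ℝ) + 1 ≤ ⌊t⌋ := by exact_mod_cast h
      exact le_abs.2 (Or.inl (by linarith))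
    · have : (⌊t⌋ : ℝ) + 2 ≤ i := by
        have : ⌊t⌋ + 2 ≤ i := by omega
        exact_mod_cast this
      exact le_abs.2 (Or.inr (by linarith))

/-- The estimate behind `ContinuousMap.bilin_one_comm`: `f` is replaced by step functions on a mesh
of size `1 / n`. -/
theorem ContinuousMap.norm_bilin_one_sub_le {K : Type*} [TopologicalSpace K] [CompactSpace K]
    (w : C(K, ℝ) →ₗ[ℝ] C(K, ℝ) →ₗ[ℝ] X) {c : ℝ} (hc : 0 ≤ c)
    (hb : ∀ f g, ‖w f g‖ ≤ c * ‖f‖ * ‖g‖) (hw : ∀ f g, f * g = 0 → w f g = 0) (f : C(K, ℝ))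
    {n : ℝ} (hn : 0 < n) : ‖w f 1 - w 1 f‖ ≤ 12 * c / n := by
  obtain ⟨N, hN⟩ : ∃ N : ℤ, n * ‖f‖ < N := exists_int_gt _
  let e : ℤ → C(K, ℝ) := fun i => ⟨fun k => hatFun (n * f k - i), by
    have := continuous_hatFun; fun_prop⟩
  let q : ℤ → C(K, ℝ) := fun i => ⟨fun k => trapFun (n * f k - i), by
    have := continuous_trapFun; fun_prop⟩
  -- The deviation of `f` from the mesh value `i / n`, of order `1 / n` wherever `e i` or `q i` is
  -- nonzero.
  let d : ℤ → C(K, ℝ) := fun i => f - ContinuousMap.const K ((i : ℝ) / n)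
  let S := Finset.Icc (-N) N
  have he : ∀ i k, e i k = hatFun (n * f k - i) := fun _ _ => rfl
  have hq : ∀ i k, q i k = trapFun (n * f k - i) := fun _ _ => rfl
  have hd : ∀ i k, d i k = (n * f k - i) / n := by
    intro i k
    change f k - i / n = _
    field_simp
  have hsum : ∑ i ∈ S, e i = 1 := by
    ext k
    rw [ContinuousMap.sum_apply]
    refine sum_hatFun (lt_of_le_of_lt ?_ hN)
    rw [abs_mul, abs_of_pos hn]
    exact mul_le_mul_of_nonneg_left (f.norm_coe_le_norm k) hn.le
  have hfi : ∀ i, f = d i + ((i : ℝ) / n) • (1 : C(K, ℝ)) := by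
    intro i; ext k; simp [d]
  have heq : ∀ i, e i * q i = e i := fun i => by
    ext k; exact hatFun_mul_trapFun _
  -- Since `e i * (1 - q i) = 0`, the other argument of `w` can be localised by `q i` at no cost.
  have hloc1 : ∀ i g, w (g * e i) 1 = w (g * e i) (q i) := by
    intro i g
    rw [← sub_eq_zero, ← map_sub]
    apply hw
    rw [mul_sub, mul_one, mul_assoc, heq, sub_self]
  have hloc2 : ∀ i g, w (e i) g = w (e i) (g * q i) := by
    intro i g
    rw [← sub_eq_zero, ← map_sub]
    apply hw
    rw [mul_sub, mul_left_comm, heq, mul_comm, sub_self]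
  -- The main terms `(i / n) • w (e i) (q i)` occur in both expansions and cancel.
  have key : w f 1 - w 1 f =
      ∑ i ∈ S, w (d i * e i) (q i) - ∑ i ∈ S, w (e i) (d i * q i) := by
    have h1 : w f 1 = ∑ i ∈ S, (w (d i * e i) (q i) + ((i : ℝ) / n) • w (e i) (q i)) := by
      have hf : f = ∑ i ∈ S, f * e i := by rw [← Finset.mul_sum, hsum, mul_one]
      conv_lhs => rw [hf, map_sum, LinearMap.sum_apply]
      refine Finset.sum_congr rfl fun i _ => ?_
      rw [hloc1]
      conv_lhs => rw [hfi i]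
      rw [add_mul, smul_mul_assoc, one_mul, map_add, map_smul]
      rfl
    have h2 : w 1 f = ∑ i ∈ S, (w (e i) (d i * q i) + ((i : ℝ) / n) • w (e i) (q i)) := by
      conv_lhs => rw [← hsum, map_sum, LinearMap.sum_apply]
      refine Finset.sum_congr rfl fun i _ => ?_
      rw [hloc2]
      conv_lhs => rw [hfi i]
      rw [add_mul, smul_mul_assoc, one_mul, map_add, map_smul]
    rw [h1, h2, Finset.sum_add_distrib, Finset.sum_add_distrib]
    abel
  have ne : ∀ i, ‖e i‖ ≤ 1 := fun i => by
    rw [ContinuousMap.norm_le _ zero_le_one]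
    intro k
    rw [he, Real.norm_of_nonneg (hatFun_nonneg _)]
    exact hatFun_le_one _
  have nq : ∀ i, ‖q i‖ ≤ 1 := fun i => by
    rw [ContinuousMap.norm_le _ zero_le_one]
    intro k
    rw [hq, Real.norm_of_nonneg (trapFun_nonneg _)]
    exact trapFun_le_one _
  have nde : ∀ i, ‖d i * e i‖ ≤ 1 / n := fun i => by
    rw [ContinuousMap.norm_le _ (by positivity)]
    intro k
    rw [ContinuousMap.mul_apply, norm_mul, hd, he, norm_div, Real.norm_of_nonneg hn.le,
      Real.norm_of_nonneg (hatFun_nonneg _), Real.norm_eq_abs, div_mul_eq_mul_div]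
    gcongr
    rcases le_total |n * f k - i| 1 with h | h
    · nlinarith [hatFun_le_one (n * f k - i), hatFun_nonneg (n * f k - i)]
    · rw [hatFun_eq_zero h]; simp
  have ndq : ∀ i, ‖d i * q i‖ ≤ 2 / n := fun i => by
    rw [ContinuousMap.norm_le _ (by positivity)]
    intro k
    rw [ContinuousMap.mul_apply, norm_mul, hd, hq, norm_div, Real.norm_of_nonneg hn.le,
      Real.norm_of_nonneg (trapFun_nonneg _), Real.norm_eq_abs, div_mul_eq_mul_div]
    gcongr
    rcases le_total |n * f k - i| 2 with h | h
    · nlinarith [trapFun_le_one (n * f k - i), trapFun_nonneg (n * f k - i)]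
    · rw [trapFun_eq_zero h]; simp
  -- Each `q i` lives where `|n * f - i| < 2`, so distinct indices in one residue class mod 4 have
  -- disjoint supports.
  have far : ∀ (r i j : ℤ), i % 4 = r → j % 4 = r → i ≠ j → q i * q j = 0 := by
    intro r i j hi hj hij
    ext k
    rw [ContinuousMap.mul_apply, hq, hq]
    have h4 : (4 : ℝ) ≤ |(i : ℝ) - j| := by
      have : (4 : ℤ) ≤ |i - j| := by
        rcases lt_or_gt_of_ne hij with h | h
        · rw [abs_of_neg (by omega)]; omega
        · rw [abs_of_pos (by omega)]; omega
      exact_mod_cast this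
    rcases le_total 2 |n * f k - i| with h | h
    · rw [trapFun_eq_zero h]; simp
    · rw [trapFun_eq_zero (t := n * f k - j)]
      · simp
      · have := abs_sub_le (i : ℝ) (n * f k) j
        rw [abs_sub_comm (i : ℝ) (n * f k)] at this
        linarith
  -- One diagonal estimate per residue class gives the factor 4; the final constant is `4 * (1 + 2)
  -- = 12`.
  have bound : ∀ (a b : ℝ) (p s : ℤ → C(K, ℝ)), 0 ≤ a → 0 ≤ b → (∀ i, ‖p i‖ ≤ a) →
      (∀ i, ‖s i‖ ≤ b) → (∀ i, ∃ g, p i = g * q i) → (∀ i, ∃ g, s i = g * q i) →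
      ‖∑ i ∈ S, w (p i) (s i)‖ ≤ 4 * (c * a * b) := by
    intro a b p s ha hb' hp hs hpq hsq
    rw [← Finset.sum_fiberwise_of_maps_to (s := S) (t := Finset.range 4)
      (g := fun i : ℤ => (i % 4).toNat) (by intro i _; simp; omega)]
    refine (norm_sum_le_of_le (n := fun _ => c * a * b) _ fun r _ => ?_).trans (by simp)
    have hfar : ∀ (p s : ℤ → C(K, ℝ)), (∀ i, ∃ g, p i = g * q i) → (∀ i, ∃ g, s i = g * q i) →
        ∀ i ∈ S.filter (fun i : ℤ => (i % 4).toNat = r),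
        ∀ j ∈ S.filter (fun i : ℤ => (i % 4).toNat = r), i ≠ j → p i * s j = 0 := by
      intro p s hpq hsq i hi j hj hij
      obtain ⟨g, hg⟩ := hpq i
      obtain ⟨g', hg'⟩ := hsq j
      rw [Finset.mem_filter] at hi hj
      rw [hg, hg', mul_mul_mul_comm, far r i j (by omega) (by omega) hij, mul_zero]
    exact ContinuousMap.norm_sum_bilin_le w hc hb hw _ p s ha hb' (fun i _ => hp i) (fun i _ => hs i)
      (hfar p p hpq hpq) (hfar s s hsq hsq) (hfar p s hpq hsq)
  have b1 := bound (1 / n) 1 (fun i => d i * e i) q (by positivity) zero_le_one nde nq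
    (fun i => ⟨d i * e i, by rw [mul_assoc, heq]⟩) (fun i => ⟨1, by rw [one_mul]⟩)
  have b2 := bound 1 (2 / n) e (fun i => d i * q i) zero_le_one (by positivity) ne ndq
    (fun i => ⟨e i, by rw [heq]⟩) (fun i => ⟨d i, rfl⟩)
  rw [key]
  refine (norm_sub_le _ _).trans ((add_le_add b1 b2).trans (le_of_eq ?_))
  ring

/-- A bounded bilinear map on `C(K, ℝ)` that vanishes on pairs with zero product is symmetric
against the unit. -/
theorem ContinuousMap.bilin_one_comm {K : Type*} [TopologicalSpace K] [CompactSpace K]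
    (w : C(K, ℝ) →ₗ[ℝ] C(K, ℝ) →ₗ[ℝ] X) {c : ℝ} (hc : 0 ≤ c)
    (hb : ∀ f g, ‖w f g‖ ≤ c * ‖f‖ * ‖g‖) (hw : ∀ f g, f * g = 0 → w f g = 0) (f : C(K, ℝ)) :
    w f 1 = w 1 f := by
  rw [← sub_eq_zero, ← norm_le_zero_iff]
  refine le_of_forall_pos_le_add fun ε hε => ?_
  -- The summand `1` keeps the mesh parameter positive when `c = 0`.
  refine (ContinuousMap.norm_bilin_one_sub_le w hc hb hw f
    (n := (12 * c + 1) / ε) (by positivity)).trans ?_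
  rw [zero_add, div_div_eq_mul_div, div_le_iff₀ (by positivity)]
  nlinarith

end ZeroProduct

/-! ### From zero products to the balance identity -/

section Balanced

variable {A B : Type*} [NonUnitalCStarAlgebra A] [NonUnitalCStarAlgebra B]

/-- A bounded bilinear map on a unital C⋆-algebra that vanishes on pairs with zero product is
symmetric against the unit, on self-adjoint elements. -/
theorem CStarAlgebra.bilin_one_comm {U X : Type*} [CStarAlgebra U] [NormedAddCommGroup X]
    [NormedSpace ℂ X] (w : U →ₗ[ℂ] U →ₗ[ℂ] X) {c : ℝ} (hc : 0 ≤ c)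
    (hb : ∀ y z, ‖w y z‖ ≤ c * ‖y‖ * ‖z‖) (hw : ∀ y z, y * z = 0 → w y z = 0)
    {x : U} (hx : IsSelfAdjoint x) : w x 1 = w 1 x := by
  let F := cfcHom (R := ℝ) hx
  have hF : ∀ f, ‖F f‖ ≤ ‖f‖ := fun f => by
    have := (isometry_cfcHom (R := ℝ) x hx).norm_map_of_map_zero (map_zero _) f
    exact this.le
  -- The pullback of `w` along the functional calculus of `x`; the coordinate function goes to `x`.
  let v : C(spectrum ℝ x, ℝ) →ₗ[ℝ] C(spectrum ℝ x, ℝ) →ₗ[ℝ] X :=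
    LinearMap.mk₂ ℝ (fun f g => w (F f) (F g))
      (fun f f' g => by simp only [map_add, LinearMap.add_apply])
      (fun r f g => by
        rw [map_smul, ← Complex.coe_smul r (F f), map_smul, LinearMap.smul_apply, Complex.coe_smul])
      (fun f g g' => by simp only [map_add])
      (fun r f g => by rw [map_smul, ← Complex.coe_smul r (F g), map_smul, Complex.coe_smul])
  have := ContinuousMap.bilin_one_comm v hc (fun f g => (hb _ _).trans (by gcongr <;> exact hF _))
    (fun f g hfg => hw _ _ (by rw [← map_mul, hfg, map_zero]))
    (ContinuousMap.restrict (spectrum ℝ x) (ContinuousMap.id ℝ))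
  have hid : F (ContinuousMap.restrict (spectrum ℝ x) (ContinuousMap.id ℝ)) = x := cfcHom_id hx
  change w (F _) (F 1) = w (F 1) (F _) at this
  rwa [hid, map_one] at this

namespace Unitization

/-- The left action of the unitization of `A` on its ideal `A`. -/
def lact : Unitization ℂ A →ₗ[ℂ] A →ₗ[ℂ] A :=
  LinearMap.mk₂ ℂ (fun z b => z.fst • b + z.snd * b)
    (fun _ _ _ => by simp only [fst_add, snd_add, add_smul, add_mul]; abel)
    (fun _ _ _ => by simp only [fst_smul, snd_smul, smul_eq_mul, mul_smul, smul_mul_assoc, smul_add])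
    (fun _ _ _ => by simp only [smul_add, mul_add]; abel)
    (fun r z b => by simp only [smul_add, mul_smul_comm, smul_comm z.fst r])

/-- The right action of the unitization of `A` on its ideal `A`. -/
def ract : A →ₗ[ℂ] Unitization ℂ A →ₗ[ℂ] A :=
  LinearMap.mk₂ ℂ (fun b z => z.fst • b + b * z.snd)
    (fun _ _ _ => by simp only [smul_add, add_mul]; abel)
    (fun r b z => by simp only [smul_add, smul_mul_assoc, smul_comm z.fst r])
    (fun _ _ _ => by simp only [fst_add, snd_add, add_smul, mul_add]; abel)
    (fun _ _ _ => by simp only [fst_smul, snd_smul, smul_eq_mul, mul_smul, mul_smul_comm, smul_add])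

theorem lact_apply (z : Unitization ℂ A) (b : A) : lact z b = z.fst • b + z.snd * b := rfl

theorem ract_apply (z : Unitization ℂ A) (b : A) : ract b z = z.fst • b + b * z.snd := rfl

theorem inr_lact (z : Unitization ℂ A) (b : A) : (lact z b : Unitization ℂ A) = z * b := by
  ext <;> simp [lact_apply]

theorem inr_ract (z : Unitization ℂ A) (b : A) : (ract b z : Unitization ℂ A) = b * z := by
  ext <;> simp [ract_apply]

theorem norm_lact_le (z : Unitization ℂ A) (b : A) : ‖lact z b‖ ≤ ‖z‖ * ‖b‖ := by
  rw [← norm_inr (𝕜 := ℂ), inr_lact, ← norm_inr (𝕜 := ℂ) (a := b)]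
  exact norm_mul_le _ _

theorem norm_ract_le (z : Unitization ℂ A) (b : A) : ‖ract b z‖ ≤ ‖b‖ * ‖z‖ := by
  rw [← norm_inr (𝕜 := ℂ), inr_ract, ← norm_inr (𝕜 := ℂ) (a := b)]
  exact norm_mul_le _ _

/-- Associativity in the unitization. This transfers the zero-product hypothesis on `A` to pairs in
the unitization, where the unit needed for `CStarAlgebra.bilin_one_comm` is available. -/
theorem ract_mul_lact (z w : Unitization ℂ A) (a b : A) (h : z * w = 0) :
    ract a z * lact w b = 0 := by
  apply inr_injective (R := ℂ)
  rw [inr_mul, inr_lact, inr_ract, mul_assoc, ← mul_assoc z, h, zero_mul, mul_zero, inr_zero]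

@[simp] theorem lact_inr (a b : A) : lact (a : Unitization ℂ A) b = a * b := by simp [lact_apply]

@[simp] theorem ract_inr (a b : A) : ract b (a : Unitization ℂ A) = b * a := by simp [ract_apply]

@[simp] theorem lact_one (b : A) : lact (1 : Unitization ℂ A) b = b := by simp [lact_apply]

@[simp] theorem ract_one (b : A) : ract b (1 : Unitization ℂ A) = b := by simp [ract_apply]

theorem star_lact (z : Unitization ℂ A) (b : A) : star (lact z b) = ract (star b) (star z) := by
  simp [lact_apply, ract_apply]

theorem lact_mul (z w : Unitization ℂ A) (b : A) : lact (z * w) b = lact z (lact w b) := by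
  apply inr_injective (R := ℂ)
  simp only [inr_lact, mul_assoc]

end Unitization

open Unitization in
/-- A bounded linear map preserving zero-products is balanced. -/
theorem map_mul_mul_map_of_zero_product (φ : A →L[ℂ] B)
    (hφ : ∀ a b : A, a * b = 0 → φ a * φ b = 0) (a b c : A) :
    φ (a * b) * φ c = φ a * φ (b * c) := by
  let w : Unitization ℂ A →ₗ[ℂ] Unitization ℂ A →ₗ[ℂ] B :=
    LinearMap.mk₂ ℂ (fun z y => φ (ract a z) * φ (lact y c))
      (fun _ _ _ => by simp only [map_add, add_mul])
      (fun _ _ _ => by simp only [map_smul, smul_mul_assoc])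
      (fun _ _ _ => by simp only [map_add, LinearMap.add_apply, mul_add])
      (fun _ _ _ => by simp only [map_smul, LinearMap.smul_apply, mul_smul_comm])
  have hsa : ∀ b : A, IsSelfAdjoint b → φ (a * b) * φ c = φ a * φ (b * c) := by
    intro b hb
    have := CStarAlgebra.bilin_one_comm w (c := (‖φ‖ * ‖a‖) * (‖φ‖ * ‖c‖)) (by positivity) (fun y z => ?_)
      (fun y z hyz => hφ _ _ (ract_mul_lact y z a c hyz)) (x := (b : Unitization ℂ A))
      (hb.inr ℂ)
    · simpa [w] using this
    · calc ‖φ (ract a y) * φ (lact z c)‖ ≤ ‖φ (ract a y)‖ * ‖φ (lact z c)‖ := norm_mul_le _ _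
        _ ≤ (‖φ‖ * (‖a‖ * ‖y‖)) * (‖φ‖ * (‖z‖ * ‖c‖)) := by
          gcongr
          · exact (φ.le_opNorm _).trans (by gcongr; exact norm_ract_le _ _)
          · exact (φ.le_opNorm _).trans (by gcongr; exact norm_lact_le _ _)
        _ = _ := by ring
  rw [← realPart_add_I_smul_imaginaryPart b]
  simp only [mul_add, add_mul, map_add, mul_smul_comm, smul_mul_assoc, map_smul]
  rw [hsa _ (realPart b).2, hsa _ (imaginaryPart b).2]

end Balanced

/-! ### Construction of the multipliers `π a` and `h` -/

section Multipliers

open Filter Topology TensorProduct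

variable {A C : Type*} [NonUnitalCStarAlgebra A] [NonUnitalCStarAlgebra C]

/-- An order-free form of the existence of approximate units in C⋆-algebras. -/
theorem exists_approximateUnit (A : Type*) [NonUnitalCStarAlgebra A] :
    ∃ l : Filter A, l.NeBot ∧ (∀ a, Tendsto (fun e => e * a) l (𝓝 a)) ∧
      (∀ a, Tendsto (fun e => a * e) l (𝓝 a)) ∧ (∀ᶠ e in l, ‖e‖ ≤ 1) ∧
      ∀ f : StrongDual ℂ A, Tendsto (fun e => Bidual.actRight f e) l (𝓝 f) := by
  let _ := CStarAlgebra.spectralOrder A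
  have _ := CStarAlgebra.spectralOrderedRing A
  have hl := CStarAlgebra.increasingApproximateUnit A
  exact ⟨_, hl.neBot, hl.tendsto_mul_right, hl.tendsto_mul_left, hl.eventually_norm,
    Bidual.tendsto_actRight⟩

/-- A double centralizer obtained by extension from a dense range. -/
theorem DoubleCentralizer.exists_of_denseRange {E : Type*} [AddCommGroup E] [Module ℂ E]
    (e f g : E →ₗ[ℂ] C) (he : DenseRange e) (hf : ∃ K : ℝ, ∀ s, ‖f s‖ ≤ K * ‖e s‖)
    (hg : ∃ K : ℝ, ∀ s, ‖g s‖ ≤ K * ‖e s‖)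
    (hfg : ∀ s t, star (g s) * e t = star (e s) * f t) :
    ∃ m : 𝓜(ℂ, C), (∀ s, m.fst (e s) = f s) ∧ ∀ s, m.snd (star (e s)) = star (g s) := by
  let L := f.extendOfNorm e
  let R := g.extendOfNorm e
  have hL : ∀ s, L (e s) = f s := LinearMap.extendOfNorm_eq he hf
  have hR : ∀ s, R (e s) = g s := LinearMap.extendOfNorm_eq he hg
  have key : ∀ x y, star (R x) * y = star x * L y := by
    intro x y
    refine he.induction_on₂ (p := fun x y => star (R x) * y = star x * L y) ?_ ?_ x y
    · exact isClosed_eq (by fun_prop) (by fun_prop)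
    · intro s t
      rw [hL, hR, hfg]
  refine ⟨⟨(L, (((starₗᵢ ℂ : C ≃ₗᵢ⋆[ℂ] C) : C →L⋆[ℂ] C).comp R).comp
    ((starₗᵢ ℂ : C ≃ₗᵢ⋆[ℂ] C) : C →L⋆[ℂ] C)), fun x y => ?_⟩, hL, fun s => ?_⟩
  · have := key (star x) y
    rwa [star_star] at this
  · change star (R (star (star (e s)))) = _
    rw [star_star, hR]

/-- The left part determines the right part, because `m.snd x * y = x * m.fst y` and an element of
`C` annihilating all of `C` is zero. -/
theorem DoubleCentralizer.ext_fst {m m' : 𝓜(ℂ, C)} (h : ∀ x, m.fst x = m'.fst x) : m = m' := by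
  refine DoubleCentralizer.ext ℂ C _ _ (Prod.ext (ContinuousLinearMap.ext h)
    (ContinuousLinearMap.ext fun x => ?_))
  have h0 : ∀ y, (m.snd x - m'.snd x) * y = 0 := fun y => by
    rw [sub_mul, m.central, m'.central, h, sub_self]
  have := h0 (star (m.snd x - m'.snd x))
  rwa [CStarRing.mul_star_self_eq_zero_iff, sub_eq_zero] at this

/-- A self-adjoint bounded linear map that is balanced and whose range generates the codomain
as a C⋆-algebra. -/
structure IsBalancedGenerator (ψ : A →L[ℂ] C) : Prop where
  map_star : ∀ a, ψ (star a) = star (ψ a)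
  balanced : ∀ a b c, ψ (a * b) * ψ c = ψ a * ψ (b * c)
  dense : Dense (NonUnitalStarAlgebra.adjoin ℂ (Set.range ψ) : Set C)

namespace IsBalancedGenerator

variable {ψ : A →L[ℂ] C} (hψ : IsBalancedGenerator ψ)

include hψ

/-- The sums of elements `ψ b * c` are dense: a product of generators begins with some `ψ b`, as the
range of `ψ` is closed under `star`, and an approximate unit of `C` supplies the factor `c`. Scalars
are absorbed into `c`. -/
theorem induction_on {p : C → Prop} (hp : IsClosed {x | p x})
    (hadd : ∀ x y, p x → p y → p (x + y)) (hmem : ∀ b c, p (ψ b * c)) (x : C) : p x := by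
  have h : ∀ x, ∀ c, p (x * c) := by
    intro x c
    have hcl : IsClosed {x | p (x * c)} := hp.preimage (by fun_prop : Continuous fun x => x * c)
    refine hcl.closure_subset_iff.2 ?_ (hψ.dense x)
    intro y hy
    have h0 : p 0 := by simpa using hmem 0 0
    -- The claim for `star y` is carried along to get through the `star` case of the induction.
    suffices (∀ c, p (y * c)) ∧ ∀ c, p (star y * c) from this.1 c
    refine NonUnitalStarAlgebra.adjoin_induction (R := ℂ) (s := Set.range ψ)
      (p := fun y _ => (∀ c, p (y * c)) ∧ ∀ c, p (star y * c)) ?_ ?_ ?_ ?_ ?_ ?_ hy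
    · rintro _ ⟨a, rfl⟩
      exact ⟨hmem a, by rw [← hψ.map_star]; exact hmem _⟩
    · intro x y _ _ hx hy
      simp only [add_mul, star_add]
      exact ⟨fun c => hadd _ _ (hx.1 c) (hy.1 c), fun c => hadd _ _ (hx.2 c) (hy.2 c)⟩
    · simpa using h0
    · intro x y _ _ hx hy
      simp only [star_mul, mul_assoc]
      exact ⟨fun c => hx.1 _, fun c => hy.2 _⟩
    · intro r x _ hx
      simp only [star_smul, smul_mul_assoc, ← mul_smul_comm]
      exact ⟨fun c => hx.1 _, fun c => hx.2 _⟩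
    · intro x _ hx
      rw [star_star]
      exact hx.symm
  obtain ⟨l, _, -, hl, -⟩ := exists_approximateUnit C
  exact hp.mem_of_tendsto (hl x) (Eventually.of_forall fun e => h x e)

/-- An approximate unit of `A` gives `ψ (e * b) * c → ψ b * c`. -/
theorem induction_on_mul {p : C → Prop} (hp : IsClosed {x | p x})
    (hadd : ∀ x y, p x → p y → p (x + y)) (hmem : ∀ a b c, p (ψ (a * b) * c)) (x : C) : p x := by
  refine hψ.induction_on hp hadd (fun b c => ?_) x
  obtain ⟨l, _, hl, -⟩ := exists_approximateUnit A
  refine hp.mem_of_tendsto (((ψ.continuous.tendsto b).comp (hl b)).mul_const c)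
    (Eventually.of_forall fun e => hmem e b c)

theorem ext_fst {m m' : 𝓜(ℂ, C)} (h : ∀ b c, m.fst (ψ b * c) = m'.fst (ψ b * c)) : m = m' :=
  DoubleCentralizer.ext_fst fun x => hψ.induction_on
    (isClosed_eq m.fst.continuous m'.fst.continuous)
    (fun x y hx hy => by rw [map_add, map_add, hx, hy]) h x

theorem ext_fst_mul {m m' : 𝓜(ℂ, C)}
    (h : ∀ a b c, m.fst (ψ (a * b) * c) = m'.fst (ψ (a * b) * c)) : m = m' :=
  DoubleCentralizer.ext_fst fun x => hψ.induction_on_mul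
    (isClosed_eq m.fst.continuous m'.fst.continuous)
    (fun x y hx hy => by rw [map_add, map_add, hx, hy]) h x

omit hψ in
variable (ψ) in
/-- The linear map `A ⊗ C → C`, `b ⊗ c ↦ ψ (z b) c`, for `z` in the unitization of `A`. -/
def lactMap : Unitization ℂ A →ₗ[ℂ] A ⊗[ℂ] C →ₗ[ℂ] C where
  toFun z := TensorProduct.lift (LinearMap.mul ℂ C ∘ₗ ψ.toLinearMap ∘ₗ Unitization.lact z)
  map_add' _ _ := by ext; simp
  map_smul' _ _ := by ext; simp

omit hψ in
@[simp] theorem lactMap_tmul (z : Unitization ℂ A) (b : A) (c : C) :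
    lactMap ψ z (b ⊗ₜ c) = ψ (Unitization.lact z b) * c := rfl

theorem star_map_lact_mul (z w : Unitization ℂ A) (a b : A) :
    star (ψ (Unitization.lact z a)) * ψ (Unitization.lact w b) =
      star (ψ a) * ψ (Unitization.lact (star z * w) b) := by
  have h : ∀ (z : Unitization ℂ A) (a b : A),
      ψ (Unitization.ract a z) * ψ b = ψ a * ψ (Unitization.lact z b) := by
    intro z a b
    simp only [Unitization.ract_apply, Unitization.lact_apply, map_add, map_smul, add_mul, mul_add,
      smul_mul_assoc, mul_smul_comm, hψ.balanced]
  rw [← hψ.map_star, Unitization.star_lact, h, ← hψ.map_star, Unitization.lact_mul]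

/-- For the `C`-valued form `star (lactMap ψ 1 s) * lactMap ψ 1 t` on `A ⊗ C`, the action of `z` has
the action of `star z` as adjoint. -/
theorem star_lactMap_mul (z w : Unitization ℂ A) (s t : A ⊗[ℂ] C) :
    star (lactMap ψ z s) * lactMap ψ w t =
      star (lactMap ψ 1 s) * lactMap ψ (star z * w) t := by
  induction s with
  | zero => simp
  | add s s' hs hs' => simp only [map_add, star_add, add_mul, hs, hs']
  | tmul a c =>
    induction t with
    | zero => simp
    | add s s' hs hs' => simp only [map_add, mul_add, hs, hs']
    | tmul b d =>
      simp only [lactMap_tmul, star_mul, Unitization.lact_one]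
      rw [mul_assoc, ← mul_assoc (star (ψ _)), hψ.star_map_lact_mul]
      simp only [mul_assoc]

/-- Write `‖z‖ ^ 2 - star z * z = star d * d`. By adjointness, `‖z‖ ^ 2` times the square of `t`
minus the square of `z t` is the square of `d t`, hence positive. The bound also makes the action
well defined on the range of `lactMap ψ 1`. -/
theorem norm_lactMap_le (z : Unitization ℂ A) (t : A ⊗[ℂ] C) :
    ‖lactMap ψ z t‖ ≤ ‖z‖ * ‖lactMap ψ 1 t‖ := by
  let _ := CStarAlgebra.spectralOrder (Unitization ℂ A)
  have _ := CStarAlgebra.spectralOrderedRing (Unitization ℂ A)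
  let _ := CStarAlgebra.spectralOrder C
  have _ := CStarAlgebra.spectralOrderedRing C
  obtain ⟨d, hd⟩ := CStarAlgebra.nonneg_iff_eq_star_mul_self.1
    (sub_nonneg.2 (CStarAlgebra.star_mul_le_algebraMap_norm_sq (a := z)))
  have h1 : star (lactMap ψ z t) * lactMap ψ z t ≤
      ((‖z‖ ^ 2 : ℝ) : ℂ) • (star (lactMap ψ 1 t) * lactMap ψ 1 t) := by
    rw [← sub_nonneg]
    have h2 := star_mul_self_nonneg (lactMap ψ d t)
    rw [hψ.star_lactMap_mul, ← hd, map_sub, LinearMap.sub_apply, mul_sub,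
      ← hψ.star_lactMap_mul z z] at h2
    convert h2 using 2
    rw [IsScalarTower.algebraMap_apply ℝ ℂ, Algebra.algebraMap_eq_smul_one, map_smul,
      LinearMap.smul_apply, mul_smul_comm]
    rfl
  have h3 := CStarAlgebra.norm_le_norm_of_nonneg_of_le (star_mul_self_nonneg _) h1
  rw [norm_smul, CStarRing.norm_star_mul_self, CStarRing.norm_star_mul_self, Complex.norm_real,
    Real.norm_of_nonneg (by positivity)] at h3
  refine le_of_sq_le_sq ?_ (by positivity)
  nlinarith

theorem denseRange_lactMap_one : DenseRange (lactMap ψ 1) := by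
  intro x
  refine hψ.induction_on (p := fun x => x ∈ closure (Set.range (lactMap ψ 1))) isClosed_closure
    (fun x y hx hy => ?_) (fun b c => subset_closure ⟨b ⊗ₜ c, by simp⟩) x
  exact map_mem_closure₂ continuous_add hx hy (by
    rintro _ ⟨s, rfl⟩ _ ⟨t, rfl⟩
    exact ⟨s + t, map_add _ _ _⟩)

/-- The multiplier `π a` with `π a (ψ b c) = ψ (a b) c`. -/
theorem exists_homMultiplier (a : A) :
    ∃ m : 𝓜(ℂ, C), (∀ b c, m.fst (ψ b * c) = ψ (a * b) * c) ∧
      ∀ b c, m.snd (c * ψ b) = c * ψ (b * a) := by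
  obtain ⟨m, h1, h2⟩ := DoubleCentralizer.exists_of_denseRange (lactMap ψ 1)
    (lactMap ψ (a : Unitization ℂ A)) (lactMap ψ (star (a : Unitization ℂ A)))
    hψ.denseRange_lactMap_one ⟨_, hψ.norm_lactMap_le _⟩ ⟨_, hψ.norm_lactMap_le _⟩
    (fun s t => by rw [hψ.star_lactMap_mul _ 1, star_star, mul_one])
  refine ⟨m, fun b c => by simpa using h1 (b ⊗ₜ c), fun b c => ?_⟩
  have := h2 (star b ⊗ₜ star c)
  simpa only [lactMap_tmul, star_mul, star_star, ← hψ.map_star, Unitization.star_lact,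
    Unitization.lact_one, Unitization.ract_inr] using this

/-- The multiplier `h` with `h (ψ (a b) c) = ψ a ψ b c`. -/
theorem exists_unitMultiplier :
    ∃ m : 𝓜(ℂ, C), (∀ a b c, m.fst (ψ (a * b) * c) = ψ a * ψ b * c) ∧
      ∀ a b c, m.snd (c * ψ (a * b)) = c * ψ a * ψ b := by
  let e : A ⊗[ℂ] (A ⊗[ℂ] C) →ₗ[ℂ] C :=
    TensorProduct.lift (lactMap ψ ∘ₗ Unitization.inrHom ℂ ℂ A)
  let f : A ⊗[ℂ] (A ⊗[ℂ] C) →ₗ[ℂ] C :=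
    TensorProduct.lift (LinearMap.lcomp ℂ C (lactMap ψ 1) ∘ₗ LinearMap.mul ℂ C ∘ₗ ψ.toLinearMap)
  have he : ∀ a b c, e (a ⊗ₜ (b ⊗ₜ c)) = ψ (a * b) * c := fun a b c => by
    simp [e]
  have hf : ∀ a b c, f (a ⊗ₜ (b ⊗ₜ c)) = ψ a * (ψ b * c) := fun a b c => by
    simp [f]
  have hdense : DenseRange e := by
    intro x
    refine hψ.induction_on_mul (p := fun x => x ∈ closure (Set.range e)) isClosed_closure
      (fun x y hx hy => ?_) (fun a b c => subset_closure ⟨a ⊗ₜ (b ⊗ₜ c), he a b c⟩) x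
    exact map_mem_closure₂ continuous_add hx hy (by
      rintro _ ⟨s, rfl⟩ _ ⟨t, rfl⟩
      exact ⟨s + t, map_add _ _ _⟩)
  have ind : ∀ {p : A ⊗[ℂ] (A ⊗[ℂ] C) → Prop}, p 0 → (∀ s t, p s → p t → p (s + t)) →
      (∀ a b c, p (a ⊗ₜ (b ⊗ₜ c))) → ∀ s, p s := by
    intro p h0 hadd hmem s
    induction s with
    | zero => exact h0
    | add s t hs ht => exact hadd s t hs ht
    | tmul a t =>
      induction t with
      | zero => simpa using h0
      | add s t hs ht => rw [TensorProduct.tmul_add]; exact hadd _ _ hs ht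
      | tmul b c => exact hmem a b c
  obtain ⟨l, _, hl, -, hl1, -⟩ := exists_approximateUnit A
  -- Balance gives `ψ u * ψ (a * b) = ψ (u * a) * ψ b`, so `f s` is the limit of `ψ u * e s` with
  -- `‖u‖ ≤ 1`.
  have hbound : ∀ s, ‖f s‖ ≤ ‖ψ‖ * ‖e s‖ := by
    intro s
    have ht : Tendsto (fun u => ψ u * e s) l (𝓝 (f s)) := by
      refine ind (p := fun s => Tendsto (fun u => ψ u * e s) l (𝓝 (f s))) (by simp)
        (fun s t hs ht => ?_) (fun a b c => ?_) s
      · simp only [map_add, mul_add]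
        exact hs.add ht
      · simp only [he, hf, ← mul_assoc, ← hψ.balanced]
        exact (((ψ.continuous.tendsto a).comp (hl a)).mul_const _).mul_const _
    refine le_of_tendsto ht.norm (hl1.mono fun u hu => (norm_mul_le _ _).trans ?_)
    gcongr
    exact (ψ.le_opNorm u).trans (mul_le_of_le_one_right (norm_nonneg _) hu)
  -- The map `f` serves on both sides because `h` is to be self-adjoint.
  obtain ⟨m, h1, h2⟩ := DoubleCentralizer.exists_of_denseRange e f f hdense ⟨_, hbound⟩
    ⟨_, hbound⟩ (by
      intro s t
      revert t
      refine ind (p := fun s => ∀ t, star (f s) * e t = star (e s) * f t) (by simp)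
        (fun s s' hs hs' t => by simp only [map_add, star_add, add_mul, hs, hs'])
        (fun a b c => ?_) s
      refine ind (by simp) (fun s s' hs hs' => by simp only [map_add, mul_add, hs, hs'])
        fun a' b' c' => ?_
      -- Both sides equal `ψ (star b) * ψ (star a * a') * ψ b'`.
      have hb : ψ (star b * star a) * ψ a' * ψ b' = ψ (star b) * ψ (star a) * ψ (a' * b') := by
        rw [hψ.balanced, mul_assoc, hψ.balanced, ← mul_assoc]
      calc star (f (a ⊗ₜ (b ⊗ₜ c))) * e (a' ⊗ₜ (b' ⊗ₜ c'))
          = star c * (ψ (star b) * ψ (star a) * ψ (a' * b')) * c' := by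
            simp only [he, hf, star_mul, ← hψ.map_star, mul_assoc]
        _ = star (e (a ⊗ₜ (b ⊗ₜ c))) * f (a' ⊗ₜ (b' ⊗ₜ c')) := by
            rw [← hb]
            simp only [he, hf, star_mul, ← hψ.map_star, mul_assoc])
  refine ⟨m, fun a b c => by rw [← he, h1, hf, mul_assoc], fun a b c => ?_⟩
  have := h2 (star b ⊗ₜ (star a ⊗ₜ star c))
  simpa only [he, hf, star_mul, star_star, ← hψ.map_star, mul_assoc] using this

end IsBalancedGenerator

end Multipliers

/-! ### The canonical homomorphism, the commutant and the bidual -/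

section CanonicalHom

open Filter Topology

variable {A C : Type*} [NonUnitalCStarAlgebra A] [NonUnitalCStarAlgebra C]

theorem DoubleCentralizer.continuous_coeHom :
    Continuous (DoubleCentralizer.coeHom (𝕜 := ℂ) (A := C)) := by
  refine AddMonoidHomClass.continuous_of_bound _ 1 fun c => ?_
  rw [← DoubleCentralizer.norm_fst, one_mul]
  exact ContinuousLinearMap.opNorm_mul_apply_le ℂ C c

namespace Bidual

theorem arens_one_apply_actRight (f : StrongDual ℂ A) (a : A) : one A (actRight f a) = f a :=
  congrArg (fun x : Bidual A => x f) (arens_one (incl a))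

/-- The unit of the bidual is the limit of approximate units. -/
theorem tendsto_one_apply {l : Filter A}
    (hl : ∀ f : StrongDual ℂ A, Tendsto (fun e => actRight f e) l (𝓝 f)) (f : StrongDual ℂ A) :
    Tendsto (fun e => f e) l (𝓝 (one A f)) := by
  simpa only [arens_one_apply_actRight, Function.comp_def] using
    ((one A).continuous.tendsto f).comp (hl f)

theorem continuous_actRight (f : StrongDual ℂ A) : Continuous (actRight f) :=
  ((ContinuousLinearMap.compL ℂ A A ℂ f) ∘L ContinuousLinearMap.mul ℂ A).continuous

/-- Elements of the bidual are determined by their products with elements of `A` from the left. -/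
theorem ext_actRight {x y : Bidual A} (h : ∀ f a, x (actRight f a) = y (actRight f a)) :
    x = y := by
  obtain ⟨l, _, -, -, -, hl⟩ := exists_approximateUnit A
  ext f
  refine tendsto_nhds_unique ((x.continuous.tendsto f).comp (hl f)) ?_
  simp only [Function.comp_def, h]
  exact (y.continuous.tendsto f).comp (hl f)

end Bidual

namespace IsBalancedGenerator

variable {ψ : A →L[ℂ] C} (hψ : IsBalancedGenerator ψ)

include hψ

/-- The canonical homomorphism `π : A → M(C)` with `π a (ψ b c) = ψ (a b) c`. -/
theorem exists_hom : ∃ π : A →⋆ₙₐ[ℂ] 𝓜(ℂ, C),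
    ∀ a b c, (π a).fst (ψ b * c) = ψ (a * b) * c := by
  choose π h1 h2 using hψ.exists_homMultiplier
  refine ⟨{ toFun := π, map_smul' := fun r a => ?_, map_zero' := ?_, map_add' := fun a b => ?_,
            map_mul' := fun a b => ?_, map_star' := fun a => ?_ }, h1⟩
  · refine hψ.ext_fst fun b c => ?_
    rw [h1]
    change _ = r • (π a).fst _
    rw [h1, smul_mul_assoc, map_smul, smul_mul_assoc]
  · refine hψ.ext_fst fun b c => ?_
    rw [h1, zero_mul, map_zero, zero_mul]
    rfl
  · refine hψ.ext_fst fun c d => ?_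
    rw [h1]
    change _ = (π a).fst _ + (π b).fst _
    rw [h1, h1, add_mul, map_add, add_mul]
  · refine hψ.ext_fst fun c d => ?_
    rw [h1]
    change _ = (π a).fst ((π b).fst _)
    rw [h1, h1, mul_assoc]
  · refine hψ.ext_fst fun c d => ?_
    rw [h1, DoubleCentralizer.star_fst, star_mul, ← hψ.map_star, h2, star_mul, star_star,
      ← hψ.map_star, star_mul, star_star]

/-- A self-adjoint multiplier commuting with the range of `ψ` commutes with `C`. -/
theorem commute_of_forall_map {h : 𝓜(ℂ, C)} (hs : star h = h)
    (hh : ∀ a, h * (ψ a : 𝓜(ℂ, C)) = (ψ a : 𝓜(ℂ, C)) * h) (c : C) :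
    h * (c : 𝓜(ℂ, C)) = (c : 𝓜(ℂ, C)) * h := by
  have hcont : Continuous (DoubleCentralizer.coeHom (𝕜 := ℂ) (A := C)) :=
    DoubleCentralizer.continuous_coeHom
  have hcl : IsClosed {c : C | h * (c : 𝓜(ℂ, C)) = (c : 𝓜(ℂ, C)) * h} :=
    isClosed_eq (continuous_const.mul hcont) (hcont.mul continuous_const)
  refine hcl.closure_subset_iff.2 ?_ (hψ.dense c)
  have hle : NonUnitalStarAlgebra.adjoin ℂ (Set.range ψ) ≤
      (NonUnitalStarSubalgebra.centralizer ℂ {h}).comap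
        (DoubleCentralizer.coeHom (𝕜 := ℂ) (A := C)) := by
    rw [NonUnitalStarAlgebra.adjoin_le_iff]
    rintro _ ⟨a, rfl⟩
    change _ ∈ NonUnitalStarSubalgebra.centralizer ℂ {h}
    rw [NonUnitalStarSubalgebra.mem_centralizer_iff]
    rintro _ rfl
    rw [hs]
    exact ⟨hh a, hh a⟩
  intro y hy
  exact (NonUnitalStarSubalgebra.mem_centralizer_iff ℂ).1 (hle hy) h rfl |>.1

/-- The structure theorem for balanced generators. -/
theorem exists_canonical : ∃ h : 𝓜(ℂ, C),
    Bidual.ofMultiplier h = Bidual.bitranspose ψ (Bidual.one A) ∧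
    (∀ c : C, h * (c : 𝓜(ℂ, C)) = (c : 𝓜(ℂ, C)) * h) ∧
    ∃ π : A →⋆ₙₐ[ℂ] 𝓜(ℂ, C),
      (∀ a : A, h * π a = π a * h) ∧
      (∀ a : A, (ψ a : 𝓜(ℂ, C)) = h * π a) ∧
      (∀ a b : A, π a * (ψ b : 𝓜(ℂ, C)) = ψ (a * b) ∧ (ψ a : 𝓜(ℂ, C)) * π b = ψ (a * b)) ∧
      (∀ ρ : A →⋆ₙₐ[ℂ] 𝓜(ℂ, C), (∀ a : A, h * ρ a = ρ a * h) →
        (∀ a : A, (ψ a : 𝓜(ℂ, C)) = h * ρ a) → ρ = π) := by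
  obtain ⟨h, h1, h2⟩ := hψ.exists_unitMultiplier
  obtain ⟨π, p1⟩ := hψ.exists_hom
  have hs : star h = h := hψ.ext_fst_mul fun a b c => by
    rw [DoubleCentralizer.star_fst, star_mul, ← hψ.map_star, star_mul, h2, h1, star_mul, star_mul,
      star_star, ← hψ.map_star, ← hψ.map_star, star_star, star_star, mul_assoc]
  -- Balance applied twice gives `ψ a * ψ b * ψ (a' * b') = ψ (a * b) * ψ a' * ψ b'`. General
  -- elements of the range follow by approximation.
  have hprod : ∀ a b, h * (ψ (a * b) : 𝓜(ℂ, C)) = (ψ (a * b) : 𝓜(ℂ, C)) * h := fun a b =>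
    hψ.ext_fst_mul fun a' b' c => by
      change h.fst (ψ (a * b) * (ψ (a' * b') * c)) = ψ (a * b) * h.fst (ψ (a' * b') * c)
      rw [h1, h1]
      simp only [← mul_assoc]
      rw [hψ.balanced a b a', mul_assoc (ψ a) (ψ (b * a')), hψ.balanced b a' b', mul_assoc (ψ a)]
  have hcomm : ∀ c : C, h * (c : 𝓜(ℂ, C)) = (c : 𝓜(ℂ, C)) * h :=
    hψ.commute_of_forall_map hs fun a => by
      obtain ⟨l, _, hl, -⟩ := exists_approximateUnit A
      have hcont : Continuous (DoubleCentralizer.coeHom (𝕜 := ℂ) (A := C)) :=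
    DoubleCentralizer.continuous_coeHom
      have ht : Tendsto (fun e => (ψ (e * a) : 𝓜(ℂ, C))) l (𝓝 (ψ a : 𝓜(ℂ, C))) :=
        (hcont.tendsto (ψ a)).comp ((ψ.continuous.tendsto a).comp (hl a))
      refine tendsto_nhds_unique (ht.const_mul h) ?_
      simp only [hprod]
      exact ht.mul_const h
  have hmul : ∀ b c, h.fst (ψ b * c) = ψ b * h.fst c := fun b c =>
    congrArg (fun m : 𝓜(ℂ, C) => m.fst c) (hcomm (ψ b))
  have hπ : ∀ a, h * π a = π a * h := fun a => hψ.ext_fst fun b c => by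
    change h.fst ((π a).fst (ψ b * c)) = (π a).fst (h.fst (ψ b * c))
    rw [p1, hmul, hmul, p1]
  have hfac : ∀ a, (ψ a : 𝓜(ℂ, C)) = h * π a := fun a => hψ.ext_fst fun b c => by
    change ψ a * (ψ b * c) = h.fst ((π a).fst (ψ b * c))
    rw [p1, h1, mul_assoc]
  have hleft : ∀ a b, π a * (ψ b : 𝓜(ℂ, C)) = ψ (a * b) := fun a b =>
    DoubleCentralizer.ext_fst fun c => p1 a b c
  refine ⟨h, Bidual.ext_actRight fun f c => ?_, hcomm, π, hπ, hfac,
    fun a b => ⟨hleft a b, ?_⟩, fun ρ hρ hρ' => ?_⟩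
  · obtain ⟨l, _, -, hl, -, hl'⟩ := exists_approximateUnit A
    -- The density principle has `ψ (a * b)` as left factor while `h.snd` is known on products with
    -- it on the right; passing to `star c` reconciles them.
    rw [← star_star c]
    refine hψ.induction_on_mul (p := fun c =>
      Bidual.ofMultiplier h (Bidual.actRight f (star c)) =
        Bidual.bitranspose ψ (Bidual.one A) (Bidual.actRight f (star c))) ?_ ?_ ?_ (star c)
    · have := Bidual.continuous_actRight f
      exact isClosed_eq (by fun_prop) (by fun_prop)
    · intro x y hx hy
      have hadd : Bidual.actRight f (star (x + y)) =
          Bidual.actRight f (star x) + Bidual.actRight f (star y) := by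
        ext z
        simp [add_mul]
      rw [hadd, map_add, map_add, hx, hy]
    · intro a b c
      have e1 : Bidual.ofMultiplier h (Bidual.actRight f (star (ψ (a * b) * c))) =
          f (h.snd (star (ψ (a * b) * c))) :=
        congrArg (fun x : Bidual C => x f) (Bidual.incl_arens_ofMultiplier h _)
      rw [e1, Bidual.bitranspose_apply]
      refine tendsto_nhds_unique ?_ (Bidual.tendsto_one_apply hl' _)
      simp only [Bidual.transpose_apply, Bidual.actRight_apply]
      refine (f.continuous.tendsto _).comp ?_
      simp only [star_mul, ← hψ.map_star, h2]
      simp only [mul_assoc, hψ.balanced]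
      exact (((ψ.continuous.tendsto _).comp (hl _)).const_mul _).const_mul _
  · rw [hfac, hfac, map_mul, mul_assoc]
  · ext1 a
    refine hψ.ext_fst fun b c => ?_
    -- `ρ a * ψ b = ρ a * h * ρ b = h * ρ (a * b) = ψ (a * b)`, so `ρ a` is determined on a dense
    -- set.
    have hρ1 : ρ a * (ψ b : 𝓜(ℂ, C)) = ψ (a * b) := by
      rw [hρ' b, hρ, ← mul_assoc, ← map_mul, ← hρ, ← hρ']
    exact congrArg (fun m : 𝓜(ℂ, C) => m.fst c) (hρ1.trans (hleft a b).symm)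

end IsBalancedGenerator

end CanonicalHom

/-! ### Passage from `B` to the generated subalgebra -/

section

variable {A B : Type*} [NonUnitalCStarAlgebra A] [NonUnitalCStarAlgebra B]

/-- The map `toCstarRange φ` as a bounded linear map. -/
def toCstarRangeCLM (φ : A →L[ℂ] B) : A →L[ℂ] cstarRange φ where
  toFun := toCstarRange φ
  map_add' _ _ := Subtype.ext (map_add φ _ _)
  map_smul' _ _ := Subtype.ext (map_smul φ _ _)
  cont := φ.continuous.subtype_mk _

theorem isBalancedGenerator_toCstarRangeCLM (φ : A →L[ℂ] B)
    (hφ_star : ∀ a : A, φ (star a) = star (φ a))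
    (hφ_zero : ∀ a b : A, a * b = 0 → φ a * φ b = 0) :
    IsBalancedGenerator (toCstarRangeCLM φ) where
  map_star a := Subtype.ext (hφ_star a)
  balanced a b c := Subtype.ext (map_mul_mul_map_of_zero_product φ hφ_zero a b c)
  dense x := by
    rw [closure_subtype]
    refine closure_mono ?_ x.2
    have hle : NonUnitalStarAlgebra.adjoin ℂ (Set.range φ) ≤
        (NonUnitalStarAlgebra.adjoin ℂ (Set.range (toCstarRangeCLM φ))).map
          (NonUnitalStarSubalgebraClass.subtype (cstarRange φ)) := by
      rw [NonUnitalStarAlgebra.adjoin_le_iff]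
      rintro _ ⟨a, rfl⟩
      exact ⟨toCstarRangeCLM φ a,
        NonUnitalStarAlgebra.subset_adjoin ℂ _ (Set.mem_range_self a), rfl⟩
    exact hle

end

theorem corollary4p6 {A B : Type*} [NonUnitalCStarAlgebra A] [NonUnitalCStarAlgebra B]
    (φ : A →L[ℂ] B)
    (hφ_star : ∀ a : A, φ (star a) = star (φ a))
    (hφ_zero : ∀ a b : A, a * b = 0 → φ a * φ b = 0) :
    ∃ h : 𝓜(ℂ, cstarRange φ),
      -- `h`, seen in `B**` through `M(C) → C** → B**`, is `φ**(1)`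
      Bidual.bitranspose (cstarRangeIncl φ) (Bidual.ofMultiplier h) =
        Bidual.bitranspose φ (Bidual.one A) ∧
      -- `h` lies in the commutant of `C`
      (∀ c : cstarRange φ, h * (c : 𝓜(ℂ, cstarRange φ)) = (c : 𝓜(ℂ, cstarRange φ)) * h) ∧
      -- the canonical homomorphism `π : A → M(C) ∩ {h}'`
      ∃ π : A →⋆ₙₐ[ℂ] 𝓜(ℂ, cstarRange φ),
        (∀ a : A, h * π a = π a * h) ∧
        (∀ a : A, (toCstarRange φ a : 𝓜(ℂ, cstarRange φ)) = h * π a) ∧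
        (∀ a b : A, π a * (toCstarRange φ b : 𝓜(ℂ, cstarRange φ)) = toCstarRange φ (a * b) ∧
          (toCstarRange φ a : 𝓜(ℂ, cstarRange φ)) * π b = toCstarRange φ (a * b)) ∧
        (∀ ρ : A →⋆ₙₐ[ℂ] 𝓜(ℂ, cstarRange φ), (∀ a : A, h * ρ a = ρ a * h) →
          (∀ a : A, (toCstarRange φ a : 𝓜(ℂ, cstarRange φ)) = h * ρ a) → ρ = π) := by
  obtain ⟨h, h1, h2⟩ :=
    (isBalancedGenerator_toCstarRangeCLM φ hφ_star hφ_zero).exists_canonical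
  -- The inclusion of `C` composed with `toCstarRangeCLM φ` is `φ`, so the bitransposes agree
  -- definitionally.
  exact ⟨h, by rw [h1]; rfl, h2⟩
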